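/- **Model.** A finite set $\Gamma$ of periodic tasks runs on a platform with several processor cores and one hardware accelerator $\mathcal H$. Task $\tau_i$ has period $T_i$, relative deadline $0<D_i\le T_i$, a unique priority and a fixed core; it releases a (finite or infinite) sequence of jobs exactly $T_i$ apart, the first at an arbitrary time. A job executes a fixed finite sequence of segments $r_{i,1},r_{i,2},\dots$ one after the other, and the jobs of a task execute one after the other. A non-accelerated segment executes on the core of its task. An accelerated segment consists of an offloading phase on the core, a processing phase on $\mathcal H$ during which the task is suspended on its core, and a finalization phase on the core. Every phase executes for at most its worst-case execution time (WCET); each phase that is carried out takes a positive time, except that the finalization phase may be empty. The WCETs of non-accelerated segments, of offloading phases and of the processing phases on $\mathcal H$ are positive. $C^{H}_{i,j}$ denotes the WCET on $\mathcal H$ of the processing phase of an accelerated segment $r_{i,j}$. Each core is scheduled by preemptive fixed priorities. The accelerator is scheduled by non-preemptive fixed priorities: it executes one processing phase at a time to completion, is never idle while a request waits, and never starts a request while a request of a higher-priority task (including one that arrives at that very instant) waits. Let $hp(i)$ and $lp(i)$ be the sets of tasks of higher and lower priority than $\tau_i$ on all cores. $R_h$ is a worst-case response-time bound of $\tau_h$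 if in every schedule of the system every job of $\tau_h$ completes within $R_h$ of its release. **Lemma.** Let $r_{i,j}$ be an accelerated segment of $\tau_i$, and suppose that every $\tau_h\in hp(i)$ has a worst-case response-time bound $R_h\le D_h$. Put $B_i=\max\{C^{H}_{l,v} : \tau_l\in lp(i),\ r_{l,v}\text{ accelerated}\}$ (with $\max\emptyset=0$), $G_h=\sum_{u:\ r_{h,u}\text{ accelerated}}C^{H}_{h,u}$, $J^A_h=D_h-G_h$ and $$W_i(t)=B_i+\sum_{\tau_h\in hp(i)}\left\lceil\frac{t+J^A_h}{T_h}\right\rceil G_h .$$ 1. If $\Phi\ge 0$ satisfies $\Phi=W_i(\Phi)$ (in particular if $\Phi$ is the least positive solution), then in every schedule each suspension of $\tau_i$ caused by $r_{i,j}$ (from the end of its offloading phase to the end of its processing phase on $\mathcal H$) lasts at most $\Phi+C^{H}_{i,j}$. 2. The same holds with $t+C^{H}_{i,j}$ for every $t\ge 0$ (in particular for every $t\in[0,D_i-C^{H}_{i,j}]$) with $W_i(t)\le t$. Moreover, a real number is the least $\Phi\ge0$ with $\Phi=W_i(\Phi)$ if and only if it is the least $t\ge0$ with $W_i(t)\le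 t$. 3. Let $$\mathcal V_i=\left\{\left\lfloor\frac{D_i+J^A_h}{T_h}\right\rfloor T_h-J^A_h \;:\; \tau_h\in hp(i),\ T_h-J^A_h<D_i\right\}\cup\{D_i\}.$$ This set is finite, and for every $\nu\in\mathcal V_i$ with $W_i(\nu)\le\nu$ each such suspension lasts at most $\nu+C^{H}_{i,j}$. -/

import Mathlib

open scoped BigOperators

/-- Where an implementation of a segment is available. -/
inductive ImplType where
  | cpu
  | hwa
  | cpuHwa

/-- Periodic tasks, statically mapped to heterogeneous cores, whose segments may be offloaded to a
single hardware accelerator. A larger value of `prio` means a higher priority. The worst-case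
execution times on the cores depend on the core. -/
structure AccelSystem (Task Core : Type*) where
  core : Task → Core
  prio : Task → ℕ
  period : Task → ℝ
  deadline : Task → ℝ
  numSeg : Task → ℕ
  impl : (i : Task) → Fin (numSeg i) → ImplType
  /-- whether the segment is accelerated -/
  accel : (i : Task) → Fin (numSeg i) → Bool
  /-- WCET of the offloading phase on a core -/
  offWcet : (i : Task) → Fin (numSeg i) → Core → ℝ
  /-- WCET of the processing phase on a core -/
  cpuWcet : (i : Task) → Fin (numSeg i) → Core → ℝ
  /-- WCET of the finalization phase on a core -/
  finWcet : (i : Task) → Fin (numSeg i) → Core → ℝ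
  /-- WCET of the processing phase on the accelerator -/
  hwaWcet : (i : Task) → Fin (numSeg i) → ℝ
  prio_injective : Function.Injective prio
  deadline_pos : ∀ i, 0 < deadline i
  deadline_le_period : ∀ i, deadline i ≤ period i
  accel_of_cpu : ∀ i j, impl i j = ImplType.cpu → accel i j = false
  accel_of_hwa : ∀ i j, impl i j = ImplType.hwa → accel i j = true
  offWcet_pos : ∀ i j, accel i j = true → 0 < offWcet i j (core i)
  hwaWcet_pos : ∀ i j, accel i j = true → 0 < hwaWcet i j
  finWcet_nonneg : ∀ i j, accel i j = true → 0 ≤ finWcet i j (core i)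
  cpuWcet_pos : ∀ i j, accel i j = false → 0 < cpuWcet i j (core i)

namespace AccelSystem

variable {Task Core : Type*}

/-- A run of the system: which jobs are released and when, how long each phase actually executes,
and the instants at which each phase begins and ends. An instant equal to `⊤` means `never`.
The `k`-th job of task `i` is indexed by `k = 0, 1, …`; only indices below `numJobs i` are
meaningful. Every segment has an offloading, a processing and a finalization phase; for a segment
that is not accelerated the first and the last of them have length zero. -/
structure Run (S : AccelSystem Task Core) where
  /-- the number of jobs released by a task, possibly infinite -/
  numJobs : Task → ℕ∞
  /-- release time of the first job -/
  offset : Task → ℝ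
  /-- actual execution time of the offloading phase -/
  offTime : (i : Task) → ℕ → Fin (S.numSeg i) → ℝ
  /-- actual execution time of the processing phase -/
  procTime : (i : Task) → ℕ → Fin (S.numSeg i) → ℝ
  /-- actual execution time of the finalization phase -/
  finTime : (i : Task) → ℕ → Fin (S.numSeg i) → ℝ
  /-- `segDone i k m`: the instant at which the job has begun its service and completed its first
  `m` segments. For `m < numSeg i` this is the instant at which segment `m` gets ready. -/
  segDone : Task → ℕ → ℕ → EReal
  /-- end of the offloading phase. For an accelerated segment, this is the instant at which the
  task suspends and its request is queued at the accelerator. -/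
  offDone : (i : Task) → ℕ → Fin (S.numSeg i) → EReal
  /-- for an accelerated segment, the start of its execution on the accelerator -/
  accStart : (i : Task) → ℕ → Fin (S.numSeg i) → EReal
  /-- end of the processing phase. For an accelerated segment, this is the instant at which the
  task is awakened. -/
  procDone : (i : Task) → ℕ → Fin (S.numSeg i) → EReal

namespace Run

variable {S : AccelSystem Task Core} (σ : S.Run)

/-- The `k`-th job of task `i` is released in the run. -/
def IsJob (i : Task) (k : ℕ) : Prop := (k : ℕ∞) < σ.numJobs i

/-- Release time of the `k`-th job. -/
def release (i : Task) (k : ℕ) : ℝ := σ.offset i + k * S.period i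

/-- Completion time of the `k`-th job. -/
def completion (i : Task) (k : ℕ) : EReal := σ.segDone i k (S.numSeg i)

/-- At time `t`, task `i` has a phase that is ready on its core and not complete. -/
def CpuPending (i : Task) (t : ℝ) : Prop :=
  ∃ k, σ.IsJob i k ∧ ∃ j : Fin (S.numSeg i),
    (σ.segDone i k j ≤ t ∧ t < σ.offDone i k j) ∨
    (S.accel i j = false ∧ σ.offDone i k j ≤ t ∧ t < σ.procDone i k j) ∨
    (σ.procDone i k j ≤ t ∧ t < σ.segDone i k (j + 1))

/-- Time at which a phase of task `i`, ready on its core at time `r` and needing `d` units of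
execution, completes under preemptive fixed-priority scheduling of that core: the phase executes
exactly when no task of higher priority on the same core is pending. -/
noncomputable def cpuFinish (i : Task) (r : EReal) (d : ℝ) : EReal :=
  sInf {x : EReal | r ≤ x ∧ ENNReal.ofReal d ≤ MeasureTheory.volume
    {t : ℝ | r ≤ t ∧ t < x ∧
      ∀ h, S.core h = S.core i → S.prio i < S.prio h → ¬ σ.CpuPending h t}}

/-- The `k`-th job of task `i` is released and its segment `j` is accelerated. -/
def IsRequest (i : Task) (k : ℕ) (j : Fin (S.numSeg i)) : Prop :=
  σ.IsJob i k ∧ S.accel i j = true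

/-- The run obeys the execution model: partitioned preemptive fixed-priority scheduling on the
cores, synchronous suspension-based offloading, and non-preemptive fixed-priority scheduling on
the accelerator. -/
structure Legal : Prop where
  -- execution times: a phase that is carried out takes time and respects its WCET;
  -- the finalization phase may be empty
  accel_times : ∀ i k j, σ.IsJob i k → S.accel i j = true →
    (0 < σ.offTime i k j ∧ σ.offTime i k j ≤ S.offWcet i j (S.core i)) ∧
    (0 < σ.procTime i k j ∧ σ.procTime i k j ≤ S.hwaWcet i j) ∧
    (0 ≤ σ.finTime i k j ∧ σ.finTime i k j ≤ S.finWcet i j (S.core i))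
  cpu_times : ∀ i k j, σ.IsJob i k → S.accel i j = false →
    σ.offTime i k j = 0 ∧
    (0 < σ.procTime i k j ∧ σ.procTime i k j ≤ S.cpuWcet i j (S.core i)) ∧
    σ.finTime i k j = 0
  -- jobs of a task, segments of a job and phases of a segment execute sequentially
  first_job : ∀ i, σ.IsJob i 0 → σ.segDone i 0 0 = (σ.release i 0 : EReal)
  next_job : ∀ i k, σ.IsJob i (k + 1) →
    σ.segDone i (k + 1) 0 = max (σ.release i (k + 1) : EReal) (σ.completion i k)
  offload : ∀ i k j, σ.IsJob i k →
    σ.offDone i k j = σ.cpuFinish i (σ.segDone i k j) (σ.offTime i k j)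
  process_cpu : ∀ i k j, σ.IsJob i k → S.accel i j = false →
    σ.procDone i k j = σ.cpuFinish i (σ.offDone i k j) (σ.procTime i k j)
  finalize : ∀ i k (j : Fin (S.numSeg i)), σ.IsJob i k →
    σ.segDone i k (j + 1) = σ.cpuFinish i (σ.procDone i k j) (σ.finTime i k j)
  -- on the accelerator a processing phase executes to completion without preemption
  offDone_le_accStart : ∀ i k j, σ.IsRequest i k j → σ.offDone i k j ≤ σ.accStart i k j
  process_acc : ∀ i k j, σ.IsRequest i k j →
    σ.procDone i k j = σ.accStart i k j + (σ.procTime i k j : EReal)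
  -- the accelerator executes at most one processing phase at a time
  exclusive : ∀ i k j i' k' j' (t : ℝ), σ.IsRequest i k j → σ.IsRequest i' k' j' →
    σ.accStart i k j ≤ t → t < σ.procDone i k j →
    σ.accStart i' k' j' ≤ t → t < σ.procDone i' k' j' →
    i = i' ∧ k = k' ∧ (j : ℕ) = j'
  -- it is never idle while a request waits
  work_conserving : ∀ i k j (t : ℝ), σ.IsRequest i k j →
    σ.offDone i k j ≤ t → t < σ.accStart i k j →
    ∃ i' k' j', σ.IsRequest i' k' j' ∧ σ.accStart i' k' j' ≤ t ∧ t < σ.procDone i' k' j'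
  -- it never starts a request while a request of higher priority waits
  priority : ∀ i k j i' k' j' (t : ℝ), σ.IsRequest i k j → σ.IsRequest i' k' j' →
    S.prio i < S.prio i' → σ.accStart i k j = (t : EReal) →
    ¬ (σ.offDone i' k' j' ≤ t ∧ t < σ.accStart i' k' j')

end Run

variable (S : AccelSystem Task Core)

/-- In every legal run every job of task `i` completes within `R` time units of its release. -/
def IsResponseTimeBound (i : Task) (R : ℝ) : Prop :=
  ∀ σ : S.Run, σ.Legal → ∀ k, σ.IsJob i k →
    σ.completion i k ≤ (σ.release i k : EReal) + (R : EReal)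

/-- In every legal run, each suspension of task `i` caused by its accelerated segment `j`, from
the end of the offloading phase to the end of the processing phase on the accelerator, lasts at
most `s`. -/
def IsSuspensionBound (i : Task) (j : Fin (S.numSeg i)) (s : ℝ) : Prop :=
  ∀ σ : S.Run, σ.Legal → ∀ k, σ.IsJob i k →
    σ.procDone i k j ≤ σ.offDone i k j + (s : EReal)

/-- Longest accelerated processing phase of a lower-priority task (`0` if there is none). -/
noncomputable def blocking (i : Task) : ℝ :=
  sSup {c : ℝ | ∃ l, S.prio l < S.prio i ∧ ∃ v : Fin (S.numSeg l),
    S.accel l v = true ∧ c = S.hwaWcet l v}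

/-- Total WCET of a task on the accelerator. -/
noncomputable def accWcet (h : Task) : ℝ :=
  ∑ u : Fin (S.numSeg h), if S.accel h u = true then S.hwaWcet h u else 0

/-- Jitter bound of a task as seen from the accelerator. -/
noncomputable def accJitter (h : Task) : ℝ := S.deadline h - S.accWcet h

/-- Blocking plus interference of higher-priority tasks in a window of length `t`. -/
noncomputable def accDemand [Fintype Task] (i : Task) (t : ℝ) : ℝ :=
  S.blocking i + ∑ h : Task with S.prio i < S.prio h,
    (⌈(t + S.accJitter h) / S.period h⌉ : ℝ) * S.accWcet h

/-- Last activation of the interfering task `h` in the window of length `deadline i`. -/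
noncomputable def lastActivation (i h : Task) : ℝ :=
  (⌊(S.deadline i + S.accJitter h) / S.period h⌋ : ℝ) * S.period h - S.accJitter h

/-- The checkpoints of task `i`. -/
def checkpoints (i : Task) : Set ℝ :=
  {ν : ℝ | ∃ h, S.prio i < S.prio h ∧ S.period h - S.accJitter h < S.deadline i ∧
    ν = S.lastActivation i h} ∪ {S.deadline i}

end AccelSystem

/-!
# Suspension bounds for tasks that share a hardware accelerator

Suppose that a request of task `i` is queued at time `a` and is still waiting at time `a + t`, where
`W t ≤ t` for the demand function `W = accDemand i`. The accelerator is busy throughout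
`[a, a + t]`, and never with task `i` itself, whose segments and jobs execute one after the other
(`Run.Legal.not_executing_of_waiting`). Its work in `[a, a + t)` is therefore made up of:

* a single lower-priority request, which must have started before `a`, so that strictly less than
  the blocking term is left of it (`Run.Legal.measureReal_lowExec_lt`);
* for every higher-priority task `h`, at most `⌈(t + J) / T⌉ * G`, where `G = accWcet h` and
  `J = D - G` (`Run.Legal.measureReal_taskExec_le`). If `h` has more jobs than that in the window,
  then the first of them is confined to the time before its deadline and the last of them to the
  time after its release, which together is less than one load `G`.

Summing up gives `t ≤ W t`. The inequality is strict, because the accelerator is still executing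
some request at `a + t`: a blocking request leaves its bound unattained in any case, and an
interfering task has either a request with time left to execute, or a last job that spent some of
the time since its release in an offloading phase. Hence `t < W t`, a contradiction
(`Run.Legal.accStart_le`).

The interference bound needs `J > 0`. The response-time bounds are assumed for all legal runs, hence
for the run in which `h` executes a single job alone with worst-case execution times; that job takes
longer than `G`, so that `G < D` (`accJitter_pos`).

The remaining claims are about the function `W`: it is monotone and nonnegative on `[0, ∞)`, so that
its least fixed point is its least pre-fixed point (`isLeast_fixed_iff`), and the checkpoints are
finitely many nonnegative numbers.
-/

namespace AccelSystem

open MeasureTheory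

variable {Task Core : Type*} {S : AccelSystem Task Core}

/-! ### Order of the instants of a legal run -/

namespace Run

variable (σ : S.Run)

lemma le_cpuFinish (i : Task) (r : EReal) (d : ℝ) : r ≤ σ.cpuFinish i r d :=
  le_sInf fun _ hx => hx.1

lemma add_le_cpuFinish (i : Task) {c d : ℝ} {r : EReal} (hc : (c : EReal) ≤ r) :
    ((c + d : ℝ) : EReal) ≤ σ.cpuFinish i r d := by
  refine le_sInf ?_
  rintro x ⟨hrx, hx⟩
  have hcx := hc.trans hrx
  induction x with
  | bot => simp at hcx
  | top => exact le_top
  | coe x =>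
    have hcx' : c ≤ x := EReal.coe_le_coe_iff.1 hcx
    have hvol : ENNReal.ofReal d ≤ volume (Set.Ico c x) :=
      hx.trans (measure_mono fun t ht =>
        ⟨EReal.coe_le_coe_iff.1 (hc.trans ht.1), EReal.coe_lt_coe_iff.1 ht.2.1⟩)
    rw [Real.volume_Ico, ENNReal.ofReal_le_ofReal_iff (by linarith)] at hvol
    exact EReal.coe_le_coe_iff.2 (by linarith)

/-- Without interference, a phase finishes as soon as it has executed for its full length. -/
lemma cpuFinish_eq_add (i : Task) {r d : ℝ} (hd : 0 ≤ d)
    (hfree : ∀ h t, S.prio i < S.prio h → ¬ σ.CpuPending h t) :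
    σ.cpuFinish i r d = ((r + d : ℝ) : EReal) := by
  refine le_antisymm (sInf_le ⟨EReal.coe_le_coe_iff.2 (by linarith), ?_⟩)
    (σ.add_le_cpuFinish i le_rfl)
  refine le_trans (le_of_eq ?_) (measure_mono (s := Set.Ico r (r + d)) fun t ht =>
    ⟨EReal.coe_le_coe_iff.2 ht.1, EReal.coe_lt_coe_iff.2 ht.2, fun h _ hp => hfree h t hp⟩)
  rw [Real.volume_Ico, add_sub_cancel_left]

namespace Legal

variable {σ} (hσ : σ.Legal) {i : Task} {k k' : ℕ}
include hσ

lemma accStart_le_procDone {j : Fin (S.numSeg i)} (hq : σ.IsRequest i k j) :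
    σ.accStart i k j ≤ σ.procDone i k j := by
  rw [hσ.process_acc i k j hq]
  exact le_add_of_nonneg_right (EReal.coe_nonneg.2 (hσ.accel_times i k j hq.1 hq.2).2.1.1.le)

lemma offDone_le_procDone (hk : σ.IsJob i k) (j : Fin (S.numSeg i)) :
    σ.offDone i k j ≤ σ.procDone i k j := by
  cases hj : S.accel i j with
  | true => exact (hσ.offDone_le_accStart i k j ⟨hk, hj⟩).trans (hσ.accStart_le_procDone ⟨hk, hj⟩)
  | false => rw [hσ.process_cpu i k j hk hj]; exact σ.le_cpuFinish _ _ _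

lemma segDone_le_offDone (hk : σ.IsJob i k) (j : Fin (S.numSeg i)) :
    σ.segDone i k j ≤ σ.offDone i k j := by
  rw [hσ.offload i k j hk]; exact σ.le_cpuFinish _ _ _

lemma procDone_le_segDone_succ (hk : σ.IsJob i k) (j : Fin (S.numSeg i)) :
    σ.procDone i k j ≤ σ.segDone i k (j + 1) := by
  rw [hσ.finalize i k j hk]; exact σ.le_cpuFinish _ _ _

lemma segDone_mono (hk : σ.IsJob i k) {m m' : ℕ} (hm : m ≤ m') (hm' : m' ≤ S.numSeg i) :
    σ.segDone i k m ≤ σ.segDone i k m' := by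
  induction m', hm using Nat.le_induction with
  | base => exact le_rfl
  | succ n _ ih =>
    exact (ih (by omega)).trans (((hσ.segDone_le_offDone hk ⟨n, hm'⟩).trans
      (hσ.offDone_le_procDone hk ⟨n, hm'⟩)).trans (hσ.procDone_le_segDone_succ hk ⟨n, hm'⟩))

lemma procDone_le_segDone (hk : σ.IsJob i k) (j : Fin (S.numSeg i)) {m : ℕ} (hjm : (j : ℕ) < m)
    (hm : m ≤ S.numSeg i) : σ.procDone i k j ≤ σ.segDone i k m :=
  (hσ.procDone_le_segDone_succ hk j).trans (hσ.segDone_mono hk hjm hm)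

omit hσ in
lemma isJob_of_le (hk' : σ.IsJob i k') (h : k ≤ k') : σ.IsJob i k :=
  lt_of_le_of_lt (Nat.cast_le.2 h) hk'

lemma release_le_segDone (hk : σ.IsJob i k) {m : ℕ} (hm : m ≤ S.numSeg i) :
    (σ.release i k : EReal) ≤ σ.segDone i k m := by
  refine le_trans ?_ (hσ.segDone_mono hk (Nat.zero_le m) hm)
  cases k with
  | zero => exact (hσ.first_job i hk).ge
  | succ k => rw [hσ.next_job i k hk]; exact le_max_left _ _

lemma completion_le_segDone (hk' : σ.IsJob i k') (h : k < k') {m : ℕ} (hm : m ≤ S.numSeg i) :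
    σ.completion i k ≤ σ.segDone i k' m := by
  refine le_trans ?_ (hσ.segDone_mono hk' (Nat.zero_le m) hm)
  induction k', h using Nat.le_induction with
  | base => rw [hσ.next_job i k hk']; exact le_max_right _ _
  | succ n _ ih =>
    have hn : σ.IsJob i n := isJob_of_le hk' n.le_succ
    refine (ih hn).trans ((hσ.segDone_mono hn (Nat.zero_le _) le_rfl).trans ?_)
    rw [hσ.next_job i n hk']; exact le_max_right _ _

/-- A request reaches the accelerator no earlier than the length of its own offloading phase after
the release of its job. -/
lemma release_add_le_offDone {j : Fin (S.numSeg i)} (hq : σ.IsRequest i k j) :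
    ((σ.release i k + σ.offTime i k j : ℝ) : EReal) ≤ σ.offDone i k j := by
  rw [hσ.offload i k j hq.1]
  exact σ.add_le_cpuFinish i (hσ.release_le_segDone hq.1 j.2.le)

/-- While a task waits for the accelerator, none of its own requests occupies the accelerator. -/
lemma not_executing_of_waiting {j j' : Fin (S.numSeg i)} (hq : σ.IsRequest i k j)
    (hq' : σ.IsRequest i k' j') {s : ℝ} (h₁ : σ.offDone i k j ≤ s) (h₂ : s < σ.accStart i k j)
    (h₁' : σ.accStart i k' j' ≤ s) (h₂' : s < σ.procDone i k' j') : False := by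
  have before : σ.procDone i k' j' ≤ σ.segDone i k j → False := fun h =>
    lt_irrefl _ (h₂'.trans_le (h.trans ((hσ.segDone_le_offDone hq.1 j).trans h₁)))
  have after : σ.procDone i k j ≤ σ.segDone i k' j' → False := fun h =>
    lt_irrefl _ (h₂.trans_le ((hσ.accStart_le_procDone hq).trans (h.trans
      ((hσ.segDone_le_offDone hq'.1 j').trans
        ((hσ.offDone_le_accStart i k' j' hq').trans h₁')))))
  rcases lt_trichotomy k k' with h | rfl | h
  · exact after ((hσ.procDone_le_segDone hq.1 j j.2 le_rfl).trans
      (hσ.completion_le_segDone hq'.1 h j'.2.le))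
  · rcases lt_trichotomy j j' with h | rfl | h
    · exact after (hσ.procDone_le_segDone hq.1 j h j'.2.le)
    · exact lt_irrefl _ (h₂.trans_le h₁')
    · exact before (hσ.procDone_le_segDone hq.1 j' h j.2.le)
  · exact before ((hσ.procDone_le_segDone hq'.1 j' j'.2 le_rfl).trans
      (hσ.completion_le_segDone hq.1 h j.2.le))

end Legal

end Run

/-! ### The accelerator load of a task is less than its deadline -/

section Solo

variable (S)

/-- Worst-case length of the offloading phase; non-accelerated segments have none. -/
noncomputable def offLength (i : Task) (j : Fin (S.numSeg i)) : ℝ :=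
  if S.accel i j = true then S.offWcet i j (S.core i) else 0

/-- Worst-case length of the processing phase, on the accelerator or on the core. -/
noncomputable def procLength (i : Task) (j : Fin (S.numSeg i)) : ℝ :=
  if S.accel i j = true then S.hwaWcet i j else S.cpuWcet i j (S.core i)

/-- Worst-case length of the finalization phase; non-accelerated segments have none. -/
noncomputable def finLength (i : Task) (j : Fin (S.numSeg i)) : ℝ :=
  if S.accel i j = true then S.finWcet i j (S.core i) else 0

lemma offLength_nonneg (i : Task) (j : Fin (S.numSeg i)) : 0 ≤ S.offLength i j := by
  unfold offLength; split_ifs with h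
  exacts [(S.offWcet_pos i j h).le, le_rfl]

lemma procLength_pos (i : Task) (j : Fin (S.numSeg i)) : 0 < S.procLength i j := by
  unfold procLength; split_ifs with h
  exacts [S.hwaWcet_pos i j h, S.cpuWcet_pos i j (by simpa using h)]

lemma finLength_nonneg (i : Task) (j : Fin (S.numSeg i)) : 0 ≤ S.finLength i j := by
  unfold finLength; split_ifs with h
  exacts [S.finWcet_nonneg i j h, le_rfl]

/-- Total worst-case length of the first `m` segments, executed without interference. -/
noncomputable def prefixLength (i : Task) (m : ℕ) : ℝ :=
  ∑ u ∈ Finset.range m, if hu : u < S.numSeg i then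
    S.offLength i ⟨u, hu⟩ + S.procLength i ⟨u, hu⟩ + S.finLength i ⟨u, hu⟩ else 0

lemma prefixLength_succ (i : Task) (j : Fin (S.numSeg i)) :
    S.prefixLength i (j + 1) =
      S.prefixLength i j + S.offLength i j + S.procLength i j + S.finLength i j := by
  rw [prefixLength, Finset.sum_range_succ, dif_pos j.2, ← prefixLength]; ring

lemma prefixLength_mono (i : Task) : Monotone (S.prefixLength i) := by
  refine monotone_nat_of_le_succ fun m => ?_
  rw [prefixLength, prefixLength, Finset.sum_range_succ]
  refine le_add_of_nonneg_right ?_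
  split_ifs with h
  · have := S.offLength_nonneg i ⟨m, h⟩
    have := S.procLength_pos i ⟨m, h⟩
    have := S.finLength_nonneg i ⟨m, h⟩
    linarith
  · exact le_rfl

open Classical in
/-- The run in which task `h` releases a single job, at time `0`, whose phases take their worst-case
execution times back to back, and no other task releases a job. -/
noncomputable def soloRun (h : Task) : S.Run where
  numJobs i := if i = h then 1 else 0
  offset _ := 0
  offTime i _ j := S.offLength i j
  procTime i _ j := S.procLength i j
  finTime i _ j := S.finLength i j
  segDone i _ m := (S.prefixLength i m : ℝ)
  offDone i _ j := (S.prefixLength i j + S.offLength i j : ℝ)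
  accStart i _ j := (S.prefixLength i j + S.offLength i j : ℝ)
  procDone i _ j := (S.prefixLength i j + S.offLength i j + S.procLength i j : ℝ)

variable {S}

lemma soloRun_isJob {h i : Task} {k : ℕ} : (S.soloRun h).IsJob i k ↔ i = h ∧ k = 0 := by
  unfold Run.IsJob soloRun
  by_cases hi : i = h
  · simp only [hi, if_true, true_and]
    exact_mod_cast Nat.lt_one_iff
  · simp [hi]

lemma soloRun_cpuFinish {h : Task} {r d : ℝ} (hd : 0 ≤ d) :
    (S.soloRun h).cpuFinish h r d = ((r + d : ℝ) : EReal) := by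
  refine Run.cpuFinish_eq_add _ _ hd ?_
  rintro h' t hp ⟨k, hk, -⟩
  rw [(soloRun_isJob.1 hk).1] at hp
  exact lt_irrefl _ hp

lemma soloRun_legal (h : Task) : (S.soloRun h).Legal where
  accel_times i k j _ hj := by
    simp only [soloRun, offLength, procLength, finLength, hj, if_true, le_refl, and_true]
    exact ⟨S.offWcet_pos i j hj, S.hwaWcet_pos i j hj, S.finWcet_nonneg i j hj⟩
  cpu_times i k j _ hj := by
    simp only [soloRun, offLength, procLength, finLength, hj, Bool.false_eq_true, if_false,
      le_refl, and_true, true_and]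
    exact S.cpuWcet_pos i j hj
  first_job i _ := by simp [soloRun, Run.release, prefixLength]
  next_job i k hk := by simpa using (soloRun_isJob.1 hk).2
  offload i k j hk := by
    obtain ⟨rfl, rfl⟩ := soloRun_isJob.1 hk
    exact (soloRun_cpuFinish (S.offLength_nonneg i j)).symm
  process_cpu i k j hk _ := by
    obtain ⟨rfl, rfl⟩ := soloRun_isJob.1 hk
    exact (soloRun_cpuFinish (S.procLength_pos i j).le).symm
  finalize i k j hk := by
    obtain ⟨rfl, rfl⟩ := soloRun_isJob.1 hk
    refine Eq.trans ?_ (soloRun_cpuFinish (S.finLength_nonneg i j)).symm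
    exact congrArg Real.toEReal (S.prefixLength_succ i j)
  offDone_le_accStart i k j _ := le_rfl
  process_acc i k j _ := EReal.coe_add _ _
  exclusive i k j i' k' j' t hq hq' h₁ h₂ h₁' h₂' := by
    obtain ⟨rfl, rfl⟩ := soloRun_isJob.1 hq.1
    obtain ⟨rfl, rfl⟩ := soloRun_isJob.1 hq'.1
    have key : ∀ u v : Fin (S.numSeg i'), u < v →
        S.prefixLength i' v + S.offLength i' v ≤ t →
        t < S.prefixLength i' u + S.offLength i' u + S.procLength i' u → False := by
      intro u v huv hv hu
      have h₃ := S.prefixLength_mono i' (show (u : ℕ) + 1 ≤ v from huv)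
      rw [S.prefixLength_succ] at h₃
      have h₄ := S.finLength_nonneg i' u
      have h₅ := S.offLength_nonneg i' v
      linarith
    replace h₁ := EReal.coe_le_coe_iff.1 h₁
    replace h₂ := EReal.coe_lt_coe_iff.1 h₂
    replace h₁' := EReal.coe_le_coe_iff.1 h₁'
    replace h₂' := EReal.coe_lt_coe_iff.1 h₂'
    refine ⟨rfl, rfl, congrArg _ ?_⟩
    rcases lt_trichotomy j j' with hlt | heq | hgt
    exacts [(key j j' hlt h₁' h₂).elim, heq, (key j' j hgt h₁ h₂').elim]
  work_conserving i k j t _ h₁ h₂ := (lt_irrefl _ (lt_of_lt_of_le h₂ h₁)).elim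
  priority i k j i' k' j' t _ _ _ _ hw := lt_irrefl _ (lt_of_lt_of_le hw.2 hw.1)

variable (S) in
lemma accWcet_nonneg (h : Task) : 0 ≤ S.accWcet h := by
  refine Finset.sum_nonneg fun u _ => ?_
  split_ifs with hu
  exacts [(S.hwaWcet_pos h u hu).le, le_rfl]

/-- A task that always completes within its deadline has a positive jitter bound: already its
execution alone on the platform takes longer than its accelerator load, because every accelerated
segment has an offloading phase. -/
lemma accJitter_pos {h : Task} {R : ℝ} (hR : S.IsResponseTimeBound h R) (hRD : R ≤ S.deadline h) :
    0 < S.accJitter h := by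
  have hc := hR (S.soloRun h) (soloRun_legal h) 0 (soloRun_isJob.2 ⟨rfl, rfl⟩)
  have hle : S.prefixLength h (S.numSeg h) ≤ R := by
    have hrel : (S.soloRun h).release h 0 = 0 := by simp [Run.release, soloRun]
    rw [hrel, EReal.coe_zero, zero_add] at hc
    exact EReal.coe_le_coe_iff.1 hc
  have hsum : S.prefixLength h (S.numSeg h) =
      ∑ u, (S.offLength h u + S.procLength h u + S.finLength h u) := by
    rw [Finset.sum_fin_eq_sum_range, prefixLength]
  have hterm : ∀ u, (if S.accel h u = true then S.hwaWcet h u else 0) <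
      S.offLength h u + S.procLength h u + S.finLength h u := by
    intro u
    have hf := S.finLength_nonneg h u
    have hp := S.procLength_pos h u
    cases hu : S.accel h u with
    | true =>
      have := S.offWcet_pos h u hu
      simp only [offLength, procLength, hu, if_true] at hp ⊢
      linarith
    | false =>
      have := S.offLength_nonneg h u
      simp only [Bool.false_eq_true, if_false]
      linarith
  have hD := S.deadline_pos h
  unfold accJitter accWcet
  rcases isEmpty_or_nonempty (Fin (S.numSeg h)) with he | hne
  · simpa using hD
  · have := Finset.sum_lt_sum_of_nonempty (s := Finset.univ) Finset.univ_nonempty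
      (fun u _ => hterm u)
    linarith

end Solo

/-! ### Accelerator work of a task inside a window -/

namespace Run

variable (σ : S.Run)

/-- The times at which the accelerator executes segment `j` of the `k`-th job of task `i`; empty
unless the job is released and the segment is accelerated. -/
def reqExec (i : Task) (k : ℕ) (j : Fin (S.numSeg i)) : Set ℝ :=
  {s | σ.IsRequest i k j ∧ σ.accStart i k j ≤ s ∧ s < σ.procDone i k j}

/-- The times at which the accelerator executes the `k`-th job of task `i`. -/
def jobExec (i : Task) (k : ℕ) : Set ℝ := ⋃ j, σ.reqExec i k j

/-- The times at which the accelerator executes task `i`. -/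
def taskExec (i : Task) : Set ℝ := ⋃ k, σ.jobExec i k

/-- The times at which the accelerator executes some task of lower priority than `i`. -/
def lowExec (i : Task) : Set ℝ :=
  {s | ∃ l, S.prio l < S.prio i ∧ s ∈ σ.taskExec l}

variable {σ}

lemma volume_inter_Ico_ne_top (A : Set ℝ) (a b : ℝ) : volume (A ∩ Set.Ico a b) ≠ ⊤ :=
  ne_top_of_le_ne_top (by rw [Real.volume_Ico]; exact ENNReal.ofReal_ne_top)
    (measure_mono Set.inter_subset_right)

lemma measureReal_le_sub_of_subset_Ico {A : Set ℝ} {a b : ℝ} (hab : a ≤ b) (h : A ⊆ Set.Ico a b) :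
    volume.real A ≤ b - a := by
  rw [← Real.volume_real_Ico_of_le hab]
  exact measureReal_mono h (by rw [Real.volume_Ico]; exact ENNReal.ofReal_ne_top)

namespace Legal

variable (hσ : σ.Legal) {i : Task} {k : ℕ}
include hσ

/-- A request that is ever executed starts at a finite instant, after its offloading phase, and
executes contiguously. -/
lemma exists_reqExec_eq {j : Fin (S.numSeg i)} {s : ℝ} (hs : s ∈ σ.reqExec i k j) :
    ∃ x : ℝ, σ.accStart i k j = x ∧ σ.release i k + σ.offTime i k j ≤ x ∧
      σ.procDone i k j = (x + σ.procTime i k j : ℝ) ∧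
      σ.reqExec i k j = Set.Ico x (x + σ.procTime i k j) := by
  obtain ⟨hq, h₁, h₂⟩ := hs
  have hrel := (hσ.release_add_le_offDone hq).trans (hσ.offDone_le_accStart i k j hq)
  have hproc := hσ.process_acc i k j hq
  unfold reqExec
  generalize σ.accStart i k j = y at *
  induction y with
  | bot => simp at hrel
  | top => simp at h₁
  | coe x =>
    rw [← EReal.coe_add] at hproc
    refine ⟨x, rfl, EReal.coe_le_coe_iff.1 hrel, hproc, ?_⟩
    ext t
    simp [hq, hproc, -EReal.coe_add]

lemma measureReal_reqExec_le (j : Fin (S.numSeg i)) (a b : ℝ) :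
    volume.real (σ.reqExec i k j ∩ Set.Ico a b) ≤
      if S.accel i j = true then S.hwaWcet i j else 0 := by
  rcases (σ.reqExec i k j).eq_empty_or_nonempty with he | ⟨s, hs⟩
  · rw [he, Set.empty_inter, measureReal_empty]
    split_ifs with hj
    exacts [(S.hwaWcet_pos i j hj).le, le_rfl]
  · obtain ⟨x, -, -, -, hx⟩ := hσ.exists_reqExec_eq hs
    have hp := (hσ.accel_times i k j hs.1.1 hs.1.2).2.1
    rw [if_pos hs.1.2]
    refine (measureReal_le_sub_of_subset_Ico (a := x) (b := x + σ.procTime i k j) (by linarith) ?_).trans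
      (by linarith)
    rw [hx]; exact Set.inter_subset_left

lemma measureReal_reqExec_lt {j : Fin (S.numSeg i)} {a b : ℝ} (hb : b ∈ σ.reqExec i k j) :
    volume.real (σ.reqExec i k j ∩ Set.Ico a b) <
      if S.accel i j = true then S.hwaWcet i j else 0 := by
  obtain ⟨x, -, -, -, hx⟩ := hσ.exists_reqExec_eq hb
  have hp := (hσ.accel_times i k j hb.1.1 hb.1.2).2.1
  rw [if_pos hb.1.2]
  rw [hx] at hb ⊢
  refine (measureReal_le_sub_of_subset_Ico (a := x) (b := b) hb.1 fun s hs => ⟨hs.1.1, hs.2.2⟩).trans_lt ?_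
  linarith [hb.2]

lemma measureReal_jobExec_le (i : Task) (k : ℕ) (a b : ℝ) :
    volume.real (σ.jobExec i k ∩ Set.Ico a b) ≤ S.accWcet i := by
  rw [jobExec, Set.iUnion_inter]
  exact (measureReal_iUnion_fintype_le _).trans
    (Finset.sum_le_sum fun j _ => hσ.measureReal_reqExec_le j a b)

/-- A job that still executes at the end of the window has not used up its whole load. -/
lemma measureReal_jobExec_lt {a b : ℝ} (hb : b ∈ σ.jobExec i k) :
    volume.real (σ.jobExec i k ∩ Set.Ico a b) < S.accWcet i := by
  obtain ⟨j₀, hj₀⟩ := Set.mem_iUnion.1 hb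
  rw [jobExec, Set.iUnion_inter]
  exact (measureReal_iUnion_fintype_le _).trans_lt
    (Finset.sum_lt_sum (fun j _ => hσ.measureReal_reqExec_le j a b)
      ⟨j₀, Finset.mem_univ _, hσ.measureReal_reqExec_lt hj₀⟩)

/-- Since offloading phases take time, a job executes on the accelerator only after its release
plus some positive delay. -/
lemma exists_release_add_le (i : Task) (k : ℕ) :
    ∃ δ > 0, ∀ s ∈ σ.jobExec i k, σ.release i k + δ ≤ s := by
  have hev : ∀ j : Fin (S.numSeg i), ∀ᶠ δ in nhdsWithin (0 : ℝ) (Set.Ioi 0),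
      σ.IsRequest i k j → δ ≤ σ.offTime i k j := by
    intro j
    by_cases hq : σ.IsRequest i k j
    · filter_upwards [Ioc_mem_nhdsGT (hσ.accel_times i k j hq.1 hq.2).1.1] with δ hδ _ using hδ.2
    · exact Filter.Eventually.of_forall fun _ h => (hq h).elim
  obtain ⟨δ, hδ, hpos⟩ := ((Filter.eventually_all.2 hev).and self_mem_nhdsWithin).exists
  refine ⟨δ, hpos, fun s hs => ?_⟩
  obtain ⟨j, hj⟩ := Set.mem_iUnion.1 hs
  obtain ⟨x, -, hx, -, hxe⟩ := hσ.exists_reqExec_eq hj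
  have := hδ j hj.1
  rw [hxe] at hj
  linarith [hj.1]

lemma lt_release_add {d s : ℝ}
    (hd : ∀ k, σ.IsJob i k → σ.completion i k ≤ (σ.release i k : EReal) + (d : EReal))
    (hs : s ∈ σ.jobExec i k) : s < σ.release i k + d := by
  obtain ⟨j, hq, -, hlt⟩ := Set.mem_iUnion.1 hs
  have h := (hσ.procDone_le_segDone hq.1 j j.2 le_rfl).trans (hd k hq.1)
  rw [← EReal.coe_add] at h
  exact EReal.coe_lt_coe_iff.1 (hlt.trans_le h)

/-- **Interference of one task.** In a window `[a, a + t)` the accelerator executes a task that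
meets its deadlines for at most `⌈(t + J) / T⌉` times its load, and for less than that if it
executes the task at the end `a + t` of the window as well.

Let the jobs executed in the window be those with indices `p, …, q`. If there are at most
`⌈(t + J) / T⌉` of them, it suffices that each executes for at most the load. Otherwise job `p`
executes only before its deadline and job `q` only after its release, and the two together
execute for less than a single load. -/
lemma measureReal_taskExec_le (hJ : 0 < S.accJitter i)
    (hd : ∀ k, σ.IsJob i k →
      σ.completion i k ≤ (σ.release i k : EReal) + (S.deadline i : EReal))
    (a : ℝ) {t : ℝ} (ht : 0 ≤ t) :
    volume.real (σ.taskExec i ∩ Set.Ico a (a + t)) ≤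
        (⌈(t + S.accJitter i) / S.period i⌉ : ℝ) * S.accWcet i ∧
      (a + t ∈ σ.taskExec i → volume.real (σ.taskExec i ∩ Set.Ico a (a + t)) <
        (⌈(t + S.accJitter i) / S.period i⌉ : ℝ) * S.accWcet i) := by
  have hT : 0 < S.period i := (S.deadline_pos i).trans_le (S.deadline_le_period i)
  have hDT := S.deadline_le_period i
  have hG := S.accWcet_nonneg i
  have hJdef : S.accJitter i = S.deadline i - S.accWcet i := rfl
  set G := S.accWcet i
  set N : ℤ := ⌈(t + S.accJitter i) / S.period i⌉ with hN
  have hN1 : 1 ≤ N := Int.one_le_ceil_iff.2 (by positivity)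
  have hN1' : (1 : ℝ) ≤ N := by exact_mod_cast hN1
  let K : Set ℕ := {k | ∃ s ∈ Set.Icc a (a + t), s ∈ σ.jobExec i k}
  rcases K.eq_empty_or_nonempty with hK | hK
  · have hnot : ∀ s ∈ Set.Icc a (a + t), s ∉ σ.taskExec i := fun s hs hmem => by
      obtain ⟨k, hk⟩ := Set.mem_iUnion.1 hmem
      exact (hK ▸ (⟨s, hs, hk⟩ : k ∈ K) : k ∈ (∅ : Set ℕ))
    have hempty : σ.taskExec i ∩ Set.Ico a (a + t) = ∅ :=
      Set.eq_empty_of_forall_notMem fun s hs => hnot s ⟨hs.2.1, hs.2.2.le⟩ hs.1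
    refine ⟨?_, fun h => (hnot _ ⟨by linarith, le_rfl⟩ h).elim⟩
    rw [hempty, measureReal_empty]
    exact mul_nonneg (by linarith) hG
  have hbdd : BddAbove K := by
    obtain ⟨M, hM⟩ := exists_nat_gt ((a + t - σ.offset i) / S.period i)
    refine ⟨M, ?_⟩
    rintro k ⟨s, hs, hk⟩
    obtain ⟨δ, hδ, hrel⟩ := hσ.exists_release_add_le i k
    have h := hrel s hk
    rw [div_lt_iff₀ hT] at hM
    have hlt : (k : ℝ) * S.period i < M * S.period i := by
      unfold release at h; linarith [hs.2]
    exact_mod_cast (lt_of_mul_lt_mul_right hlt hT.le).le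
  set p := sInf K
  set q := sSup K
  have hp : p ∈ K := Nat.sInf_mem hK
  have hq : q ∈ K := Nat.sSup_mem hK hbdd
  have hpq : p ≤ q := Nat.sInf_le hq
  set w : ℕ → ℝ := fun k => volume.real (σ.jobExec i k ∩ Set.Ico a (a + t)) with hw
  have hwG : ∀ k, w k ≤ G := fun k => hσ.measureReal_jobExec_le i k a (a + t)
  have hsum : volume.real (σ.taskExec i ∩ Set.Ico a (a + t)) ≤ ∑ k ∈ Finset.Icc p q, w k := by
    refine (measureReal_mono ?_ ?_).trans (measureReal_biUnion_finset_le _ _)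
    · rintro s ⟨hs, hsI⟩
      obtain ⟨k, hk⟩ := Set.mem_iUnion.1 hs
      have hkK : k ∈ K := ⟨s, ⟨hsI.1, hsI.2.le⟩, hk⟩
      exact Set.mem_biUnion
        (Finset.mem_coe.2 (Finset.mem_Icc.2 ⟨Nat.sInf_le hkK, le_csSup hbdd hkK⟩)) ⟨hk, hsI⟩
    · refine ne_top_of_le_ne_top (volume_inter_Ico_ne_top (σ.taskExec i) a (a + t))
        (measure_mono ?_)
      exact Set.iUnion₂_subset fun k _ =>
        Set.inter_subset_inter_left _ (Set.subset_iUnion (σ.jobExec i) k)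
  have hcard : ∑ _k ∈ Finset.Icc p q, G = ((q : ℝ) - p + 1) * G := by
    rw [Finset.sum_const, Nat.card_Icc, nsmul_eq_mul, Nat.cast_sub (by omega)]
    push_cast; ring
  rcases le_or_gt ((q : ℤ) - p + 1) N with hfew | hmany
  · have hfew' : (q : ℝ) - p + 1 ≤ N := by exact_mod_cast hfew
    have hle := mul_le_mul_of_nonneg_right hfew' hG
    refine ⟨?_, fun hend => ?_⟩
    · have := Finset.sum_le_sum fun k (_ : k ∈ Finset.Icc p q) => hwG k
      linarith
    · obtain ⟨k, hk⟩ := Set.mem_iUnion.1 hend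
      have hkK : k ∈ K := ⟨a + t, ⟨by linarith, le_rfl⟩, hk⟩
      have := Finset.sum_lt_sum (fun k (_ : k ∈ Finset.Icc p q) => hwG k)
        ⟨k, Finset.mem_Icc.2 ⟨Nat.sInf_le hkK, le_csSup hbdd hkK⟩, hσ.measureReal_jobExec_lt hk⟩
      linarith
  · suffices hlt : volume.real (σ.taskExec i ∩ Set.Ico a (a + t)) < N * G from
      ⟨hlt.le, fun _ => hlt⟩
    have hne : p ≠ q := by omega
    obtain ⟨δ, hδ, hrel⟩ := hσ.exists_release_add_le i q
    obtain ⟨s, hs, hsp⟩ := hp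
    obtain ⟨s', hs', hsq⟩ := hq
    have hap := hσ.lt_release_add hd hsp
    have hqb := hrel s' hsq
    have hwp : w p ≤ σ.release i p + S.deadline i - a :=
      measureReal_le_sub_of_subset_Ico (by linarith [hs.1]) fun x hx => ⟨hx.2.1, hσ.lt_release_add hd hx.1⟩
    have hwq : w q ≤ a + t - (σ.release i q + δ) :=
      measureReal_le_sub_of_subset_Ico (by linarith [hs'.2]) fun x hx => ⟨hrel x hx.1, hx.2.2⟩
    have hrpq : σ.release i q = σ.release i p + ((q : ℝ) - p) * S.period i := by
      unfold release; ring
    have hpair : (G - w p) + (G - w q) ≤ ∑ k ∈ Finset.Icc p q, (G - w k) := by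
      rw [← Finset.sum_pair (f := fun k => G - w k) hne]
      refine Finset.sum_le_sum_of_subset_of_nonneg ?_ fun k _ _ => sub_nonneg.2 (hwG k)
      intro k hk
      rw [Finset.mem_insert, Finset.mem_singleton] at hk
      rw [Finset.mem_Icc]; omega
    rw [Finset.sum_sub_distrib, hcard] at hpair
    -- More than `⌈(t + J) / T⌉` jobs means that `t + D - G ≤ (q - p) T`.
    have hNle : (N : ℝ) ≤ (q : ℝ) - p := by
      have : N ≤ (q : ℤ) - p := by omega
      exact_mod_cast this
    have htJ : t + S.accJitter i ≤ ((q : ℝ) - p) * S.period i :=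
      (div_le_iff₀ hT).1 ((Int.le_ceil _).trans hNle)
    -- There is a single job too many: `(q - p) T < t + D`, as job `p` meets its deadline after `a`
    -- and job `q` is released before `a + t`, and `t + D = t + J + G` with `G ≤ T`.
    have hNge : ((q : ℝ) - p) ≤ N := by
      have h : ((q : ℝ) - p - 1) * S.period i < N * S.period i := by
        have := (div_le_iff₀ hT).1 (Int.le_ceil ((t + S.accJitter i) / S.period i))
        rw [← hN] at this
        linarith [hs.1, hs'.2]
      have h' : (q : ℝ) - p - 1 < N := lt_of_mul_lt_mul_right h hT.le
      have h'' : (q : ℤ) - p - 1 < N := by exact_mod_cast h'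
      have h3 : (q : ℤ) - p ≤ N := by omega
      exact_mod_cast h3
    have hmul := mul_le_mul_of_nonneg_right hNge hG
    linarith

end Legal

end Run

/-! ### Demand and blocking -/

lemma finite_blocking (S : AccelSystem Task Core) [Finite Task] (i : Task) :
    {c : ℝ | ∃ l, S.prio l < S.prio i ∧ ∃ v : Fin (S.numSeg l),
      S.accel l v = true ∧ c = S.hwaWcet l v}.Finite := by
  refine (Set.finite_range fun x : Σ l, Fin (S.numSeg l) => S.hwaWcet x.1 x.2).subset ?_
  rintro c ⟨l, -, v, -, rfl⟩
  exact ⟨⟨l, v⟩, rfl⟩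

lemma blocking_nonneg (S : AccelSystem Task Core) (i : Task) : 0 ≤ S.blocking i := by
  refine Real.sSup_nonneg ?_
  rintro c ⟨l, -, v, hv, rfl⟩
  exact (S.hwaWcet_pos l v hv).le

lemma hwaWcet_le_blocking [Finite Task] {i l : Task} (hl : S.prio l < S.prio i)
    {v : Fin (S.numSeg l)} (hv : S.accel l v = true) : S.hwaWcet l v ≤ S.blocking i :=
  le_csSup (S.finite_blocking i).bddAbove ⟨l, hl, v, hv, rfl⟩

lemma period_pos (S : AccelSystem Task Core) (h : Task) : 0 < S.period h :=
  (S.deadline_pos h).trans_le (S.deadline_le_period h)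

section Demand

variable [Fintype Task] {i : Task}

lemma accDemand_mono (S : AccelSystem Task Core) (i : Task) : Monotone (S.accDemand i) := by
  intro x y hxy
  refine add_le_add_right (Finset.sum_le_sum fun h _ => ?_) _
  refine mul_le_mul_of_nonneg_right (Int.cast_le.2 (Int.ceil_mono ?_)) (S.accWcet_nonneg h)
  exact div_le_div_of_nonneg_right (by linarith) (S.period_pos h).le

lemma accDemand_nonneg (hJ : ∀ h, S.prio i < S.prio h → 0 < S.accJitter h) {t : ℝ} (ht : 0 ≤ t) :
    0 ≤ S.accDemand i t := by
  refine add_nonneg (S.blocking_nonneg i) (Finset.sum_nonneg fun h hh => ?_)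
  have := hJ h (Finset.mem_filter.1 hh).2
  have := S.period_pos h
  exact mul_nonneg (Int.cast_nonneg (Int.ceil_nonneg (by positivity))) (S.accWcet_nonneg h)

/-- For a monotone function that is nonnegative on `[0, ∞)`, a real number is the least
nonnegative fixed point iff it is the least nonnegative pre-fixed point. -/
lemma isLeast_fixed_iff {W : ℝ → ℝ} (hW : Monotone W) (hW₀ : ∀ t, 0 ≤ t → 0 ≤ W t) (Φ : ℝ) :
    IsLeast {x : ℝ | 0 ≤ x ∧ x = W x} Φ ↔ IsLeast {t : ℝ | 0 ≤ t ∧ W t ≤ t} Φ := by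
  have fixed : ∀ c, IsLeast {t : ℝ | 0 ≤ t ∧ W t ≤ t} c → c = W c := fun c hc =>
    le_antisymm (hc.2 ⟨hW₀ c hc.1.1, hW hc.1.2⟩) hc.1.2
  constructor
  · rintro ⟨⟨h₀, hΦ⟩, hmin⟩
    refine ⟨⟨h₀, hΦ.ge⟩, fun t ht => ?_⟩
    -- The infimum of the pre-fixed points is one itself.
    have hbdd : BddBelow {t : ℝ | 0 ≤ t ∧ W t ≤ t} := ⟨0, fun x hx => hx.1⟩
    have hc : IsLeast {t : ℝ | 0 ≤ t ∧ W t ≤ t} (sInf {t : ℝ | 0 ≤ t ∧ W t ≤ t}) :=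
      ⟨⟨le_csInf ⟨t, ht⟩ fun x hx => hx.1,
        le_csInf ⟨t, ht⟩ fun x hx => (hW (csInf_le hbdd hx)).trans hx.2⟩,
        fun x hx => csInf_le hbdd hx⟩
    exact (hmin ⟨hc.1.1, fixed _ hc⟩).trans (csInf_le hbdd ht)
  · exact fun h => ⟨⟨h.1.1, fixed Φ h⟩, fun x hx => h.2 ⟨hx.1, hx.2.ge⟩⟩

end Demand

/-! ### The waiting time of a request -/

namespace Run.Legal

variable {σ : S.Run} (hσ : σ.Legal) {i : Task} {k : ℕ} {j : Fin (S.numSeg i)}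
include hσ

/-- **Blocking.** While a request waits, the accelerator executes a single request of lower
priority at most. It has started strictly before the wait, so that strictly less than its WCET
remains. -/
lemma measureReal_lowExec_lt [Finite Task] (hq : σ.IsRequest i k j) {a t : ℝ}
    (ha : σ.offDone i k j = a) (hwait : ((a + t : ℝ) : EReal) < σ.accStart i k j)
    {s : ℝ} (hs : s ∈ Set.Icc a (a + t)) (hlow : s ∈ σ.lowExec i) :
    volume.real (σ.lowExec i ∩ Set.Ico a (a + t)) < S.blocking i := by
  have start_lt : ∀ l, S.prio l < S.prio i → ∀ k' (v : Fin (S.numSeg l)),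
      ∀ s ∈ Set.Icc a (a + t), s ∈ σ.reqExec l k' v → σ.accStart l k' v < a := by
    intro l hl k' v s hs hmem
    obtain ⟨x, hx, -⟩ := hσ.exists_reqExec_eq hmem
    by_contra hge
    rw [hx, not_lt] at hge
    refine hσ.priority l k' v i k j x hmem.1 hq hl hx ⟨ha.trans_le hge, ?_⟩
    exact (hx.symm.trans_le hmem.2.1).trans_lt
      ((EReal.coe_le_coe_iff.2 hs.2).trans_lt hwait)
  have mem_at : ∀ l, S.prio l < S.prio i → ∀ k' (v : Fin (S.numSeg l)),
      ∀ s ∈ Set.Icc a (a + t), s ∈ σ.reqExec l k' v → a ∈ σ.reqExec l k' v :=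
    fun l hl k' v s hs hmem => ⟨hmem.1, (start_lt l hl k' v s hs hmem).le,
      (EReal.coe_le_coe_iff.2 hs.1).trans_lt hmem.2.2⟩
  have unfold_low : ∀ {s}, s ∈ σ.lowExec i → ∃ l, S.prio l < S.prio i ∧ ∃ k' v,
      s ∈ σ.reqExec l k' v := by
    rintro s ⟨l, hl, hmem⟩
    obtain ⟨k', hk'⟩ := Set.mem_iUnion.1 hmem
    obtain ⟨v, hv⟩ := Set.mem_iUnion.1 hk'
    exact ⟨l, hl, k', v, hv⟩
  obtain ⟨l, hl, k', v, hv⟩ := unfold_low hlow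
  obtain ⟨x, hx, -, -, hxe⟩ := hσ.exists_reqExec_eq hv
  have hxa : x < a := by
    have := start_lt l hl k' v s hs hv
    rw [hx] at this
    exact EReal.coe_lt_coe_iff.1 this
  have hav := mem_at l hl k' v s hs hv
  have hsub : σ.lowExec i ∩ Set.Ico a (a + t) ⊆ Set.Ico a (x + σ.procTime l k' v) := by
    rintro y ⟨hy, hyI⟩
    obtain ⟨l', hl', k'', v', hv'⟩ := unfold_low hy
    have hav' := mem_at l' hl' k'' v' y ⟨hyI.1, hyI.2.le⟩ hv'
    obtain ⟨rfl, rfl, hvv⟩ := hσ.exclusive l k' v l' k'' v' a hav.1 hav'.1 hav.2.1 hav.2.2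
      hav'.2.1 hav'.2.2
    obtain rfl := Fin.ext hvv
    rw [hxe] at hv'
    exact ⟨hyI.1, hv'.2⟩
  rw [hxe] at hav
  have hvol := measureReal_le_sub_of_subset_Ico hav.2.le hsub
  have hp := (hσ.accel_times l k' v hv.1.1 hv.1.2).2.1.2
  linarith [hwaWcet_le_blocking hl hv.1.2]

/-- If the accelerator demand of a window of length `t` fits into the window, no request waits
longer than `t`: otherwise the accelerator would be busy with blocking and interference throughout
`[a, a + t]`, and the request executing at the end of that window has not executed for all of the
time that the demand allots to it. -/
lemma accStart_le [Fintype Task] (hq : σ.IsRequest i k j)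
    (hJ : ∀ h, S.prio i < S.prio h → 0 < S.accJitter h)
    (hd : ∀ h, S.prio i < S.prio h → ∀ k, σ.IsJob h k →
      σ.completion h k ≤ (σ.release h k : EReal) + (S.deadline h : EReal))
    {a t : ℝ} (ha : σ.offDone i k j = a) (ht : 0 ≤ t) (hdem : S.accDemand i t ≤ t) :
    σ.accStart i k j ≤ (a + t : ℝ) := by
  by_contra! hwait
  have busy : ∀ s ∈ Set.Icc a (a + t),
      s ∈ σ.lowExec i ∨ ∃ h, S.prio i < S.prio h ∧ s ∈ σ.taskExec h := by
    intro s hs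
    have h₁ : σ.offDone i k j ≤ s := ha.trans_le (EReal.coe_le_coe_iff.2 hs.1)
    have h₂ : s < σ.accStart i k j := (EReal.coe_le_coe_iff.2 hs.2).trans_lt hwait
    obtain ⟨h, k', j', hq', h₁', h₂'⟩ := hσ.work_conserving i k j s hq h₁ h₂
    have hmem : s ∈ σ.taskExec h :=
      Set.mem_iUnion.2 ⟨k', Set.mem_iUnion.2 ⟨j', hq', h₁', h₂'⟩⟩
    rcases lt_trichotomy (S.prio h) (S.prio i) with hlt | heq | hgt
    · exact Or.inl ⟨h, hlt, hmem⟩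
    · obtain rfl := S.prio_injective heq
      exact (hσ.not_executing_of_waiting hq hq' h₁ h₂ h₁' h₂').elim
    · exact Or.inr ⟨h, hgt, hmem⟩
  let I := Set.Ico a (a + t)
  let H : Finset Task := Finset.univ.filter fun h => S.prio i < S.prio h
  have htotal : t ≤ volume.real (σ.lowExec i ∩ I) +
      ∑ h ∈ H, volume.real (σ.taskExec h ∩ I) := by
    have hcover : I ⊆ (σ.lowExec i ∩ I) ∪ ⋃ h ∈ H, σ.taskExec h ∩ I := by
      intro s hs
      rcases busy s ⟨hs.1, hs.2.le⟩ with hl | ⟨h, hh, hmem⟩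
      · exact Or.inl ⟨hl, hs⟩
      · exact Or.inr (Set.mem_biUnion (Finset.mem_coe.2 (Finset.mem_filter.2
          ⟨Finset.mem_univ h, hh⟩)) ⟨hmem, hs⟩)
    have hfin : volume ((σ.lowExec i ∩ I) ∪ ⋃ h ∈ H, σ.taskExec h ∩ I) ≠ ⊤ := by
      refine ne_top_of_le_ne_top (volume_inter_Ico_ne_top Set.univ a (a + t)) (measure_mono ?_)
      rw [Set.univ_inter]
      exact Set.union_subset Set.inter_subset_right
        (Set.iUnion₂_subset fun h _ => Set.inter_subset_right)
    have hI : volume.real I = t := by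
      rw [Real.volume_real_Ico_of_le (by linarith)]; ring
    rw [← hI]
    refine (measureReal_mono hcover hfin).trans ((measureReal_union_le _ _).trans ?_)
    exact add_le_add_right (measureReal_biUnion_finset_le _ _) _
  have hlow : volume.real (σ.lowExec i ∩ I) ≤ S.blocking i := by
    rcases (σ.lowExec i ∩ I).eq_empty_or_nonempty with he | ⟨s, hs, hsI⟩
    · rw [he, measureReal_empty]; exact S.blocking_nonneg i
    · exact (hσ.measureReal_lowExec_lt hq ha hwait ⟨hsI.1, hsI.2.le⟩ hs).le
  have hhigh := fun h (hh : h ∈ H) =>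
    have hp := (Finset.mem_filter.1 hh).2
    hσ.measureReal_taskExec_le (hJ h hp) (hd h hp) a ht
  have hlt : volume.real (σ.lowExec i ∩ I) + ∑ h ∈ H, volume.real (σ.taskExec h ∩ I) <
      S.accDemand i t := by
    have hend : a + t ∈ Set.Icc a (a + t) := ⟨by linarith, le_rfl⟩
    rcases busy _ hend with hl | ⟨h, hp, hmem⟩
    · exact add_lt_add_of_lt_of_le (hσ.measureReal_lowExec_lt hq ha hwait hend hl)
        (Finset.sum_le_sum fun h hh => (hhigh h hh).1)
    · have hh : h ∈ H := Finset.mem_filter.2 ⟨Finset.mem_univ h, hp⟩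
      exact add_lt_add_of_le_of_lt hlow
        (Finset.sum_lt_sum (fun h hh => (hhigh h hh).1) ⟨h, hh, (hhigh h hh).2 hmem⟩)
  linarith

end Run.Legal

lemma isSuspensionBound_of_accDemand_le [Fintype Task] {i : Task} {j : Fin (S.numSeg i)}
    (hj : S.accel i j = true) {R : Task → ℝ}
    (hR : ∀ h, S.prio i < S.prio h → S.IsResponseTimeBound h (R h))
    (hRD : ∀ h, S.prio i < S.prio h → R h ≤ S.deadline h)
    {t : ℝ} (ht : 0 ≤ t) (hdem : S.accDemand i t ≤ t) :
    S.IsSuspensionBound i j (t + S.hwaWcet i j) := by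
  intro σ hσ k hk
  have hq : σ.IsRequest i k j := ⟨hk, hj⟩
  have hrel := hσ.release_add_le_offDone hq
  have hstart := fun a ha => hσ.accStart_le (a := a) hq
    (fun h hp => accJitter_pos (hR h hp) (hRD h hp))
    (fun h hp k' hk' => (hR h hp σ hσ k' hk').trans
      (add_le_add_right (EReal.coe_le_coe_iff.2 (hRD h hp)) _)) ha ht hdem
  rw [hσ.process_acc i k j hq]
  have hp := (hσ.accel_times i k j hk hj).2.1.2
  generalize σ.offDone i k j = y at *
  induction y with
  | bot => simp at hrel
  | top => simp
  | coe a =>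
    refine (add_le_add (hstart a rfl) (EReal.coe_le_coe_iff.2 hp)).trans (le_of_eq ?_)
    rw [← EReal.coe_add, ← EReal.coe_add, add_assoc]

lemma finite_checkpoints [Finite Task] (S : AccelSystem Task Core) (i : Task) :
    (S.checkpoints i).Finite := by
  refine Set.Finite.union ((Set.finite_range (S.lastActivation i)).subset ?_)
    (Set.finite_singleton _)
  rintro ν ⟨h, -, -, rfl⟩
  exact ⟨h, rfl⟩

lemma checkpoint_nonneg {i : Task} {ν : ℝ} (hν : ν ∈ S.checkpoints i) : 0 ≤ ν := by
  rcases hν with ⟨h, -, hlt, rfl⟩ | rfl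
  · have hT := S.period_pos h
    have hfloor : (1 : ℝ) ≤ ⌊(S.deadline i + S.accJitter h) / S.period h⌋ := by
      have : (1 : ℤ) ≤ ⌊(S.deadline i + S.accJitter h) / S.period h⌋ := by
        rw [Int.le_floor, Int.cast_one, le_div_iff₀ hT]; linarith
      exact_mod_cast this
    have h₁ := mul_le_mul_of_nonneg_right hfloor hT.le
    have h₂ := S.deadline_le_period h
    have h₃ := S.accWcet_nonneg h
    unfold lastActivation accJitter at *
    linarith
  · exact (S.deadline_pos i).le

end AccelSystem

theorem lemma2 {Task Core : Type*} [Fintype Task] (S : AccelSystem Task Core)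
    (i : Task) (j : Fin (S.numSeg i)) (hj : S.accel i j = true)
    (R : Task → ℝ)
    (hR : ∀ h, S.prio i < S.prio h → S.IsResponseTimeBound h (R h))
    (hRD : ∀ h, S.prio i < S.prio h → R h ≤ S.deadline h) :
    (∀ Φ : ℝ, 0 ≤ Φ → Φ = S.accDemand i Φ →
      S.IsSuspensionBound i j (Φ + S.hwaWcet i j)) ∧
    (∀ t : ℝ, 0 ≤ t → S.accDemand i t ≤ t →
      S.IsSuspensionBound i j (t + S.hwaWcet i j)) ∧
    (∀ Φ : ℝ, IsLeast {x : ℝ | 0 ≤ x ∧ x = S.accDemand i x} Φ ↔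
      IsLeast {t : ℝ | 0 ≤ t ∧ S.accDemand i t ≤ t} Φ) ∧
    (S.checkpoints i).Finite ∧
    (∀ ν ∈ S.checkpoints i, S.accDemand i ν ≤ ν →
      S.IsSuspensionBound i j (ν + S.hwaWcet i j)) := by
  have bound : ∀ t : ℝ, 0 ≤ t → S.accDemand i t ≤ t →
      S.IsSuspensionBound i j (t + S.hwaWcet i j) := fun _ =>
    AccelSystem.isSuspensionBound_of_accDemand_le hj hR hRD
  refine ⟨fun Φ h₀ hΦ => bound Φ h₀ hΦ.ge, bound, ?_, S.finite_checkpoints i,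
    fun ν hν => bound ν (AccelSystem.checkpoint_nonneg hν)⟩
  exact AccelSystem.isLeast_fixed_iff (S.accDemand_mono i) fun _ =>
    AccelSystem.accDemand_nonneg fun h hp => AccelSystem.accJitter_pos (hR h hp) (hRD h hp)
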